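/- Let $k$ be an algebraically closed field, let $G$ be a connected reductive $k$-group (a Zariski-closed connected subgroup of some $\mathrm{GL}_{n,k}$ with trivial unipotent radical), let $T \subset G$ be a maximal torus, and let $(X^*(T), \Phi; X_*(T), \Phi^\vee)$ be the (reduced) root datum of $(G,T)$, with pairing $\langle\,,\rangle$ and Weyl group $W$. Suppose that $G$ is simple, i.e. that $\Phi$ is nonempty and irreducible (not the union of two nonempty mutually orthogonal subsets). A character $\chi \in X^*(T)$ is called * *quasi-constant* if $\langle \chi, w\alpha^\vee\rangle / \langle \chi, \alpha^\vee\rangle \in \{-1,0,1\}$ for all $w \in W$ and all $\alpha \in \Phi$ with $\langle \chi, \alpha^\vee\rangle \neq 0$; * *minuscule* if $\langle \chi, \alpha^\vee\rangle \in \{0,1,-1\}$ for all $\alpha \in \Phi$; * *cominuscule* (for $G$ semisimple) if there are a basis of simple roots $\Delta \subset \Phi$ and $\alpha \in \Delta$ such that $\chi$ is the fundamental weight $\eta(\alpha)$, i.e. $\langle \chi, \alpha^\vee\rangle = 1$ and $\langle \chi, \beta^\vee\rangle = 0$ for $\beta \in \Delta\setminus\{\alpha\}$, and such that the fundamental coweight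 $\eta(\alpha^\vee) \in X_*(T)_{\mathbf Q}$, defined by $\langle \alpha, \eta(\alpha^\vee)\rangle = 1$ and $\langle \beta, \eta(\alpha^\vee)\rangle = 0$ for $\beta \in \Delta\setminus\{\alpha\}$, is minuscule, i.e. $\langle \gamma, \eta(\alpha^\vee)\rangle \in \{0,1,-1\}$ for all $\gamma \in \Phi$. The same notions for cocharacters $\mu \in X_*(T)$ are obtained by exchanging roots with coroots and weights with coweights. 1. If $G$ is simply-connected (i.e. $\mathbf{Z}\Phi^\vee = X_*(T)$), then a character of $T$ is quasi-constant if and only if it is an integer multiple of a character of $T$ which is minuscule or cominuscule. 2. If $G$ is adjoint (i.e. $\mathbf{Z}\Phi = X^*(T)$), then a cocharacter of $T$ is quasi-constant if and only if it is an integer multiple of a cocharacter of $T$ which is minuscule or cominuscule. -/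

import Mathlib

open scoped TensorProduct

/-!
## Linear algebraic groups over a field, as Zariski-closed subgroups of `GL n`

Over an algebraically closed field `k`, smooth affine `k`-groups are the same thing as
Zariski-closed subgroups of the groups `GL (Fin n) k`.
-/

namespace LinAlgGroup

variable {k : Type*} [Field k] {n : ℕ}

/-- The value at `g` of a polynomial in the matrix entries. -/
noncomputable def evalEntries (g : GL (Fin n) k) (p : MvPolynomial (Fin n × Fin n) k) : k :=
  MvPolynomial.eval (fun ij => (g : Matrix (Fin n) (Fin n) k) ij.1 ij.2) p

/-- Zariski-closed subsets of `GL n`. -/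
def IsZariskiClosed (S : Set (GL (Fin n) k)) : Prop :=
  ∃ I : Set (MvPolynomial (Fin n × Fin n) k), S = {g | ∀ p ∈ I, evalEntries g p = 0}

/-- A subset of `GL n` is connected if it is not the union of two disjoint nonempty relatively
closed subsets. -/
def IsZariskiConnected (S : Set (GL (Fin n) k)) : Prop :=
  ∀ A B : Set (GL (Fin n) k), IsZariskiClosed A → IsZariskiClosed B →
    S ⊆ A ∪ B → S ∩ A ∩ B = ∅ → S ⊆ A ∨ S ⊆ B

/-- All elements are unipotent matrices. -/
def IsUnipotent (U : Subgroup (GL (Fin n) k)) : Prop :=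
  ∀ u ∈ U, IsNilpotent ((u : Matrix (Fin n) (Fin n) k) - 1)

/-- Connected reductive groups: closed connected subgroups of `GL n` whose only closed connected
normal unipotent subgroup is the trivial one. -/
structure IsConnectedReductive (G : Subgroup (GL (Fin n) k)) : Prop where
  isClosed : IsZariskiClosed (G : Set (GL (Fin n) k))
  isConnected : IsZariskiConnected (G : Set (GL (Fin n) k))
  unipotentRadical_eq_bot : ∀ U : Subgroup (GL (Fin n) k), U ≤ G →
    IsZariskiClosed (U : Set (GL (Fin n) k)) → IsZariskiConnected (U : Set (GL (Fin n) k)) →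
    (∀ g ∈ G, ∀ u ∈ U, g * u * g⁻¹ ∈ U) → IsUnipotent U → U = ⊥

/-- Tori (over an algebraically closed field): closed connected diagonalizable subgroups. -/
structure IsTorus (T : Subgroup (GL (Fin n) k)) : Prop where
  isClosed : IsZariskiClosed (T : Set (GL (Fin n) k))
  isConnected : IsZariskiConnected (T : Set (GL (Fin n) k))
  diagonalizable : ∃ g : GL (Fin n) k, ∀ t ∈ T,
    ((g * t * g⁻¹ : GL (Fin n) k) : Matrix (Fin n) (Fin n) k).IsDiag

/-- Maximal tori of `G`. -/
structure MaximalTorus (G : Subgroup (GL (Fin n) k)) where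
  /-- The underlying group. -/
  toSubgroup : Subgroup (GL (Fin n) k)
  le : toSubgroup ≤ G
  isTorus : IsTorus toSubgroup
  maximal : ∀ T' : Subgroup (GL (Fin n) k), T' ≤ G → IsTorus T' → toSubgroup ≤ T' →
    T' = toSubgroup

theorem IsTorus.mul_comm {T : Subgroup (GL (Fin n) k)} (hT : IsTorus T) (a b : T) :
    a * b = b * a := by
  obtain ⟨g, hg⟩ := hT.diagonalizable
  obtain ⟨a, ha⟩ := a
  obtain ⟨b, hb⟩ := b
  have key : (g * a * g⁻¹) * (g * b * g⁻¹) = (g * b * g⁻¹) * (g * a * g⁻¹) := by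
    apply Units.ext
    have ha' := hg a ha
    have hb' := hg b hb
    generalize g * a * g⁻¹ = x at ha' ⊢
    generalize g * b * g⁻¹ = y at hb' ⊢
    rw [Units.val_mul, Units.val_mul, ← ha'.diagonal_diag, ← hb'.diagonal_diag,
      Matrix.diagonal_mul_diagonal, Matrix.diagonal_mul_diagonal]
    congr 1
    funext i
    exact _root_.mul_comm _ _
  have h2 : g * (a * b) * g⁻¹ = g * (b * a) * g⁻¹ := by
    simpa [mul_assoc] using key
  exact Subtype.ext (mul_left_cancel (mul_right_cancel h2))

variable {G : Subgroup (GL (Fin n) k)}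

instance (T : MaximalTorus G) : CommGroup T.toSubgroup :=
  { (inferInstance : Group T.toSubgroup) with mul_comm := T.isTorus.mul_comm }

/-- A homomorphism `χ : T → k ˣ` is a morphism of varieties if `χ t` is a polynomial in the
entries of `t` and of `t⁻¹`. -/
def IsRegularChar (T : MaximalTorus G) (χ : T.toSubgroup →* kˣ) : Prop :=
  ∃ p : MvPolynomial ((Fin n × Fin n) ⊕ (Fin n × Fin n)) k, ∀ t : T.toSubgroup,
    (χ t : k) = MvPolynomial.eval
      (Sum.elim (fun ij => ((t : GL (Fin n) k) : Matrix (Fin n) (Fin n) k) ij.1 ij.2)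
        (fun ij => ((t⁻¹ : T.toSubgroup) : GL (Fin n) k).1 ij.1 ij.2)) p

/-- A homomorphism `μ : k ˣ → T` is a morphism of varieties if the entries of `μ x` are
polynomials in `x` and `x⁻¹`. -/
def IsRegularCochar (T : MaximalTorus G) (μ : kˣ →* T.toSubgroup) : Prop :=
  ∀ i j : Fin n, ∃ p : MvPolynomial (Fin 2) k, ∀ x : kˣ,
    ((μ x : GL (Fin n) k) : Matrix (Fin n) (Fin n) k) i j
      = MvPolynomial.eval ![(x : k), ((x⁻¹ : kˣ) : k)] p

/-- The characters of `T`, as a multiplicative group. -/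
def charSubgroup (T : MaximalTorus G) : Subgroup (T.toSubgroup →* kˣ) where
  carrier := {χ | IsRegularChar T χ}
  one_mem' := ⟨1, fun t => by simp⟩
  mul_mem' := by
    rintro χ ψ ⟨p, hp⟩ ⟨q, hq⟩
    exact ⟨p * q, fun t => by simp [hp, hq]⟩
  inv_mem' := by
    rintro χ ⟨p, hp⟩
    refine ⟨MvPolynomial.rename Sum.swap p, fun t => ?_⟩
    have h1 : (χ⁻¹) t = χ t⁻¹ := by simp
    rw [h1, hp, MvPolynomial.eval_rename]
    congr 2
    funext s
    rcases s with s | s <;> simp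

/-- The cocharacters of `T`, as a multiplicative group. -/
def cocharSubgroup (T : MaximalTorus G) : Subgroup (kˣ →* T.toSubgroup) where
  carrier := {μ | IsRegularCochar T μ}
  one_mem' := fun i j => ⟨MvPolynomial.C ((1 : Matrix (Fin n) (Fin n) k) i j), fun x => by simp⟩
  mul_mem' := by
    intro μ ν hμ hν i j
    choose p hp using hμ
    choose q hq using hν
    refine ⟨∑ l, p i l * q l j, fun x => ?_⟩
    simp [Matrix.mul_apply, hp, hq]
  inv_mem' := by
    intro μ hμ i j
    obtain ⟨p, hp⟩ := hμ i j
    refine ⟨MvPolynomial.rename (Equiv.swap 0 1) p, fun x => ?_⟩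
    have h1 : (μ⁻¹) x = μ x⁻¹ := by simp
    rw [h1, hp, MvPolynomial.eval_rename]
    congr 2
    funext s
    fin_cases s <;> simp

/-- The character group `X^*(T)`, written additively. -/
abbrev CharGroup (T : MaximalTorus G) : Type _ := Additive (charSubgroup T)

/-- The cocharacter group `X_*(T)`, written additively. -/
abbrev CocharGroup (T : MaximalTorus G) : Type _ := Additive (cocharSubgroup T)

/-- A character as a homomorphism `T → k ˣ`. -/
def CharGroup.hom {T : MaximalTorus G} (χ : CharGroup T) : T.toSubgroup →* kˣ :=
  (Additive.toMul χ : charSubgroup T).1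

/-- A cocharacter as a homomorphism `k ˣ → T`. -/
def CocharGroup.hom {T : MaximalTorus G} (μ : CocharGroup T) : kˣ →* T.toSubgroup :=
  (Additive.toMul μ : cocharSubgroup T).1

/-- `X` lies in the Lie algebra of `G` (the tangent space at `1`): the derivative at `1` in the
direction `X` of every polynomial vanishing on `G` is zero. -/
def MemLie (G : Subgroup (GL (Fin n) k)) (X : Matrix (Fin n) (Fin n) k) : Prop :=
  ∀ p : MvPolynomial (Fin n × Fin n) k, (∀ g ∈ G, evalEntries g p = 0) →
    ∑ ij : Fin n × Fin n, X ij.1 ij.2 * evalEntries 1 (MvPolynomial.pderiv ij p) = 0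

/-- The set `Φ(G, T)` of roots: the nonzero weights of the adjoint action of `T` on `Lie G`. -/
def roots (T : MaximalTorus G) : Set (CharGroup T) :=
  {α | α ≠ 0 ∧ ∃ X : Matrix (Fin n) (Fin n) k, X ≠ 0 ∧ MemLie G X ∧
    ∀ t : T.toSubgroup,
      ((t : GL (Fin n) k) : Matrix (Fin n) (Fin n) k) * X
          * ((t⁻¹ : T.toSubgroup) : GL (Fin n) k).1
        = (α.hom t : k) • X}

/-- `μ` is the coroot of `α`: one has `⟨α, μ⟩ = 2`, and the reflection
`t ↦ t * μ (α t)⁻¹` of `T` is conjugation by an element of `G`. -/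
def IsCoroot (T : MaximalTorus G) (α : CharGroup T) (μ : CocharGroup T) : Prop :=
  (∀ x : kˣ, α.hom (μ.hom x) = x ^ 2) ∧
  ∃ g ∈ G, ∀ t : T.toSubgroup,
    g * (t : GL (Fin n) k) * g⁻¹ = ((t * (μ.hom (α.hom t))⁻¹ : T.toSubgroup) : GL (Fin n) k)

/-- `P` is the (reduced) root datum `(X^*(T), Φ; X_*(T), Φ^∨)` of the pair `(G, T)`: its pairing is
`χ (μ x) = x ^ ⟨χ, μ⟩`, its roots are those of `T` in `G`, each with its own coroot. -/
structure IsRootDatum (T : MaximalTorus G)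
    (P : RootDatum (roots T) (CharGroup T) (CocharGroup T)) : Prop where
  pairing : ∀ (χ : CharGroup T) (μ : CocharGroup T) (x : kˣ),
    χ.hom (μ.hom x) = x ^ (P.toLinearMap χ μ)
  root : ∀ α : roots T, P.root α = α
  coroot : ∀ α : roots T, IsCoroot T α (P.coroot α)
  isReduced : P.IsReduced

end LinAlgGroup

/-!
## Characters of root data

Everything is stated for the weight lattice `X` of a root datum `P`. The notions for cocharacters
are those for the dual root datum `P.flip`.
-/

namespace RootDatum

variable {ι X Y : Type*} [AddCommGroup X] [AddCommGroup Y]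

/-- The root system is irreducible: nonempty, and not a union of two nonempty mutually orthogonal
subsets. For a semisimple group over an algebraically closed field, this says that the group is
simple. -/
def IsSimple (P : RootDatum ι X Y) : Prop :=
  Nonempty ι ∧ ∀ s : Set ι, s.Nonempty → sᶜ.Nonempty → ∃ i ∈ s, ∃ j ∈ sᶜ, P.pairing i j ≠ 0

/-- Semisimple and simply-connected: the coroots span the cocharacter lattice over `ℤ`. -/
def IsSimplyConnected (P : RootDatum ι X Y) : Prop :=
  Submodule.span ℤ (Set.range P.coroot) = ⊤

/-- Semisimple and adjoint: the roots span the character lattice over `ℤ`. -/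
def IsAdjoint (P : RootDatum ι X Y) : Prop :=
  Submodule.span ℤ (Set.range P.root) = ⊤

/-- `χ` is quasi-constant: if `⟨χ, α^∨⟩ ≠ 0` then `⟨χ, w α^∨⟩ / ⟨χ, α^∨⟩ ∈ {-1, 0, 1}` for all `w`
in the Weyl group. -/
def IsQuasiConstant (P : RootDatum ι X Y) (χ : X) : Prop :=
  ∀ i : ι, P.toLinearMap χ (P.coroot i) ≠ 0 → ∀ w : P.weylGroup,
    (P.toLinearMap χ (P.coroot (P.weylGroupToPerm w i)) : ℚ) / (P.toLinearMap χ (P.coroot i) : ℚ)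
      ∈ ({-1, 0, 1} : Set ℚ)

/-- `χ` is minuscule: `⟨χ, α^∨⟩ ∈ {0, 1, -1}` for every root `α`. -/
def IsMinuscule (P : RootDatum ι X Y) (χ : X) : Prop :=
  ∀ i : ι, P.toLinearMap χ (P.coroot i) ∈ ({0, 1, -1} : Set ℤ)

/-- The pairing `⟨ξ, α^∨⟩` for `ξ ∈ X_ℚ`. -/
noncomputable def ratPairing (P : RootDatum ι X Y) (i : ι) : ℚ ⊗[ℤ] X →ₗ[ℚ] ℚ :=
  LinearMap.liftBaseChange ℚ ((Algebra.linearMap ℤ ℚ).comp (P.coroot' i))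

/-- `ξ ∈ X_ℚ` is minuscule. -/
def IsRatMinuscule (P : RootDatum ι X Y) (ξ : ℚ ⊗[ℤ] X) : Prop :=
  ∀ i : ι, P.ratPairing i ξ ∈ ({0, 1, -1} : Set ℚ)

/-- `ξ ∈ X_ℚ` is the fundamental weight attached to the simple root with index `i`. -/
def IsFundamentalWeight (P : RootDatum ι X Y) (b : P.Base) (i : ι) (ξ : ℚ ⊗[ℤ] X) : Prop :=
  P.ratPairing i ξ = 1 ∧ ∀ j ∈ b.support, j ≠ i → P.ratPairing j ξ = 0

/-- `χ` is cominuscule: for some base and some simple root `α`, `χ` is the fundamental weight of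
`α`, and the fundamental coweight of `α^∨` is minuscule. -/
def IsCominuscule (P : RootDatum ι X Y) (χ : X) : Prop :=
  ∃ b : P.Base, ∃ i ∈ b.support, IsFundamentalWeight P b i (1 ⊗ₜ[ℤ] χ) ∧
    ∃ η : ℚ ⊗[ℤ] Y, IsFundamentalWeight P.flip b.flip i η ∧ IsRatMinuscule P.flip η

end RootDatum

/-! Write `(·,·)` for the canonical form `P.RootForm`; it satisfies `2(χ,α) = (α,α)⟨χ,α^∨⟩`. Given
two roots, a Weyl group element makes them non-orthogonal without changing lengths. Quasi-constancy,
tested on reflections in these two roots, then shows that nonzero values of `χ` on their coroots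
have equal size or are inversely proportional to the squared lengths
(`IsQuasiConstant.abs_eq_or_length_mul_abs_eq`).

If all nonzero values have the same size, dividing by it gives a minuscule character, because the
coroots span. Otherwise `(α,α)|⟨χ,α^∨⟩|` is a constant `c` wherever it is nonzero. For a base making
`χ` dominant, a root with only positive simple coefficients shows that `χ` is nonzero on a single
simple coroot; hence `χ` is a multiple of a fundamental weight, and its rescaled image under the
form is the minuscule fundamental coweight (`IsSimplyConnected.exists_isCominuscule`).

Conversely, for a cominuscule character the same length relation holds, and lengths are
Weyl-invariant. The statement on cocharacters is the one on characters for `P.flip`. -/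

namespace RootDatum

variable {ι X Y : Type*} [AddCommGroup X] [AddCommGroup Y]

/-! ### Root lengths, Weyl orbits and quasi-constancy. -/

section Length

variable [Fintype ι] (P : RootDatum ι X Y)

/-- Twice the canonical form, evaluated at a weight and a root. -/
lemma two_mul_rootForm_root (χ : X) (i : ι) :
    2 * P.RootForm χ (P.root i) =
      P.RootForm (P.root i) (P.root i) * P.toLinearMap χ (P.coroot i) := by
  have h := congrArg (P.toLinearMap χ) (P.rootForm_self_smul_coroot i)
  simp only [map_smul, map_nsmul, smul_eq_mul, P.toLinearMap_apply_apply_Polarization] at h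
  rw [← P.rootForm_symmetric.eq, RingHom.id_apply, h, nsmul_eq_mul, Nat.cast_ofNat]

lemma rootForm_root_self_pos (i : ι) : 0 < P.RootForm (P.root i) (P.root i) :=
  P.rootForm_pos_of_ne_zero (Submodule.subset_span ⟨i, rfl⟩) (P.ne_zero i)

lemma rootForm_root_weylGroup (w : P.weylGroup) (i : ι) :
    P.RootForm (P.root (P.weylGroupToPerm w i)) (P.root (P.weylGroupToPerm w i)) =
      P.RootForm (P.root i) (P.root i) := by
  have h := RootPairing.InvariantForm.apply_weylGroup_smul (P := P)
    (B := (P.posRootForm ℤ).toInvariantForm) w (P.root i) (P.root i)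
  rwa [P.weylGroup_apply_root] at h

end Length

lemma pairingIn_int_eq (P : RootDatum ι X Y) (i j : ι) : P.pairingIn ℤ i j = P.pairing i j := by
  simpa using P.algebraMap_pairingIn ℤ i j

lemma weylGroupToPerm_ofIdx (P : RootDatum ι X Y) (i j : ι) :
    P.weylGroupToPerm (RootPairing.weylGroup.ofIdx P i) j = P.reflectionPerm i j := rfl

lemma toLinearMap_coroot_reflectionPerm (P : RootDatum ι X Y) (χ : X) (i j : ι) :
    P.toLinearMap χ (P.coroot (P.reflectionPerm i j)) =
      P.toLinearMap χ (P.coroot j) - P.pairing i j * P.toLinearMap χ (P.coroot i) := by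
  rw [← P.reflectionPerm_coroot i j, map_sub, map_smul]
  rfl

/-- In an irreducible root datum, no root is orthogonal to a whole Weyl orbit of roots. -/
lemma IsSimple.exists_weylGroup_pairing_ne_zero {P : RootDatum ι X Y} (hP : IsSimple P) (i j : ι) :
    ∃ w : P.weylGroup, P.pairing i (P.weylGroupToPerm w j) ≠ 0 := by
  by_contra! hi
  -- Roots not orthogonal to the whole orbit of `j` form a nonempty proper subset, so some `k`
  -- inside is linked to some `l` outside. Reflecting `w j` in `k` gives an orbit element not
  -- orthogonal to `l`.
  obtain ⟨k, ⟨w, hw⟩, l, hl, hkl⟩ :=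
    hP.2 {k | ∃ w : P.weylGroup, P.pairing k (P.weylGroupToPerm w j) ≠ 0}
      ⟨j, 1, by simp⟩ ⟨i, by simpa using hi⟩
  replace hl : ∀ w : P.weylGroup, P.pairing l (P.weylGroupToPerm w j) = 0 := by simpa using hl
  have h := hl (RootPairing.weylGroup.ofIdx P k * w)
  rw [map_mul, Equiv.Perm.mul_apply, weylGroupToPerm_ofIdx] at h
  have h' := toLinearMap_coroot_reflectionPerm P (P.root l) k (P.weylGroupToPerm w j)
  simp only [RootPairing.root_coroot_eq_pairing] at h'
  rw [h, hl w, zero_sub, eq_comm, neg_eq_zero, mul_eq_zero] at h'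
  exact h'.elim hw fun h0 ↦ hkl (P.pairing_eq_zero_iff'.mp h0)

lemma ratCast_div_mem_iff {a b : ℤ} (hb : b ≠ 0) :
    (a : ℚ) / b ∈ ({-1, 0, 1} : Set ℚ) ↔ a = 0 ∨ |a| = |b| := by
  have hb' : (b : ℚ) ≠ 0 := by exact_mod_cast hb
  simp only [Set.mem_insert_iff, Set.mem_singleton_iff, div_eq_iff hb', abs_eq_abs]
  norm_cast
  grind

lemma isQuasiConstant_iff {P : RootDatum ι X Y} {χ : X} :
    IsQuasiConstant P χ ↔ ∀ (i : ι) (w : P.weylGroup), P.toLinearMap χ (P.coroot i) ≠ 0 →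
      P.toLinearMap χ (P.coroot (P.weylGroupToPerm w i)) = 0 ∨
      |P.toLinearMap χ (P.coroot (P.weylGroupToPerm w i))| = |P.toLinearMap χ (P.coroot i)| := by
  exact ⟨fun h i w hi ↦ (ratCast_div_mem_iff hi).mp (h i hi w),
    fun h i hi w ↦ (ratCast_div_mem_iff hi).mpr (h i w hi)⟩

/-! ### Comparing the values of a quasi-constant character on two coroots. -/

section Comparison

variable [Fintype ι] {P : RootDatum ι X Y} [P.IsReduced]

lemma pairing_pairing_mem (P : RootDatum ι X Y) [P.IsReduced] (i j : ι) :
    (P.pairing i j, P.pairing j i) ∈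
      ({(0, 0), (1, 1), (-1, -1), (1, 2), (2, 1), (-1, -2), (-2, -1), (1, 3), (3, 1), (-1, -3),
        (-3, -1), (2, 2), (-2, -2)} : Set (ℤ × ℤ)) := by
  have := Module.IsReflexive.of_isPerfPair P.toLinearMap
  have := Module.IsReflexive.of_isPerfPair P.flip.toLinearMap
  simpa only [pairingIn_int_eq] using P.pairingIn_pairingIn_mem_set_of_isCrystal_of_isRed i j

/-- The nonzero values of a quasi-constant character on two coroots either have the same size, or
are inversely proportional to the lengths of the roots. -/
lemma IsQuasiConstant.abs_eq_or_length_mul_abs_eq (hP : IsSimple P) {χ : X}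
    (hχ : IsQuasiConstant P χ) {i j : ι} (hi : P.toLinearMap χ (P.coroot i) ≠ 0)
    (hj : P.toLinearMap χ (P.coroot j) ≠ 0) :
    |P.toLinearMap χ (P.coroot i)| = |P.toLinearMap χ (P.coroot j)| ∨
    P.RootForm (P.root i) (P.root i) * |P.toLinearMap χ (P.coroot i)| =
      P.RootForm (P.root j) (P.root j) * |P.toLinearMap χ (P.coroot j)| := by
  have := Module.IsReflexive.of_isPerfPair P.toLinearMap
  have := Module.IsReflexive.of_isPerfPair P.flip.toLinearMap
  rw [isQuasiConstant_iff] at hχ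
  -- Put `l = w j`. Quasi-constancy is used on `l` and `s_i l` (against `j`) and on `s_l i` (against
  -- `i`).
  obtain ⟨w, hw⟩ := hP.exists_weylGroup_pairing_ne_zero i j
  have hx := hχ j w hj
  have hx' := hχ j (RootPairing.weylGroup.ofIdx P i * w) hj
  rw [map_mul, Equiv.Perm.mul_apply, weylGroupToPerm_ofIdx,
    toLinearMap_coroot_reflectionPerm] at hx'
  have hy := hχ i (RootPairing.weylGroup.ofIdx P (P.weylGroupToPerm w j)) hi
  rw [weylGroupToPerm_ofIdx, toLinearMap_coroot_reflectionPerm] at hy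
  have hlen := rootForm_root_weylGroup P w j
  generalize P.weylGroupToPerm w j = l at *
  have hpair := (P.posRootForm ℤ).toInvariantForm.pairing_mul_eq_pairing_mul_swap i l
  change P.pairing l i * P.RootForm (P.root i) (P.root i) =
    P.pairing i l * P.RootForm (P.root l) (P.root l) at hpair
  rw [hlen] at hpair
  have hset := pairing_pairing_mem P i l
  have h22 : P.pairing i l = 2 → P.pairing l i = 2 →
      P.toLinearMap χ (P.coroot l) = P.toLinearMap χ (P.coroot i) := fun h h' ↦ by
    rw [(P.pairing_two_two_iff i l).mp ⟨h, h'⟩]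
  have h22' : P.pairing i l = -2 → P.pairing l i = -2 →
      P.toLinearMap χ (P.coroot l) = -P.toLinearMap χ (P.coroot i) := fun h h' ↦ by
    rw [P.root_eq_neg_iff.mp ((P.pairing_neg_two_neg_two_iff i l).mp ⟨h, h'⟩)]
    simp
  generalize P.pairing i l = p at *
  generalize P.pairing l i = q at *
  generalize P.toLinearMap χ (P.coroot l) = x at *
  generalize P.toLinearMap χ (P.coroot i) = a at *
  generalize P.toLinearMap χ (P.coroot j) = b at *
  generalize P.RootForm (P.root i) (P.root i) = L at *
  generalize P.RootForm (P.root j) (P.root j) = K at *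
  simp only [Set.mem_insert_iff, Set.mem_singleton_iff, Prod.mk.injEq] at hset
  -- `L` and `K` are the squared lengths of `i` and `j`. The list is asymmetric: when `K = 3 * L`,
  -- the three conditions already force `|a| = |b|`.
  have key : |a| = |b| ∨ (L = 2 * K ∧ |b| = 2 * |a|) ∨ (L = 3 * K ∧ |b| = 3 * |a|) ∨
      (K = 2 * L ∧ |a| = 2 * |b|) := by
    rcases hset with ⟨rfl, rfl⟩ | ⟨rfl, rfl⟩ | ⟨rfl, rfl⟩ | ⟨rfl, rfl⟩ | ⟨rfl, rfl⟩ | ⟨rfl, rfl⟩ |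
      ⟨rfl, rfl⟩ | ⟨rfl, rfl⟩ | ⟨rfl, rfl⟩ | ⟨rfl, rfl⟩ | ⟨rfl, rfl⟩ | ⟨rfl, rfl⟩ | ⟨rfl, rfl⟩ <;>
    simp only [abs_eq_abs] at * <;> grind
  rcases key with h | ⟨rfl, h⟩ | ⟨rfl, h⟩ | ⟨rfl, h⟩
  · exact .inl h
  all_goals right; rw [h]; ring

end Comparison

end RootDatum

namespace RootDatum

variable {ι X Y : Type*} [AddCommGroup X] [AddCommGroup Y]

/-! ### Existence of a base for which a given weight is dominant. -/

section Base

variable [Fintype ι] (P : RootDatum ι X Y)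

/-- There is a regular coweight in the closure of whose chamber the weight `χ` lies. -/
lemma exists_regular_coweight (χ : X) :
    ∃ y : Y, (∀ j, P.toLinearMap (P.root j) y ≠ 0) ∧
      ∀ j, 0 < P.toLinearMap χ (P.coroot j) → 0 < P.toLinearMap (P.root j) y := by
  classical
  suffices ∀ s : Finset ι, ∃ y : Y, (∀ j ∈ s, P.toLinearMap (P.root j) y ≠ 0) ∧
      ∀ j, 0 < P.toLinearMap χ (P.coroot j) → 0 < P.toLinearMap (P.root j) y by
    simpa using this Finset.univ
  intro s
  induction s using Finset.induction_on with
  | empty =>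
    -- This coweight takes the value `(χ, α_j)` on `α_j`, which has the sign of `⟨χ, α_j^∨⟩`.
    refine ⟨P.Polarization χ, by simp, fun j hj ↦ ?_⟩
    rw [P.toLinearMap_apply_apply_Polarization]
    have := mul_pos (rootForm_root_self_pos P j) hj
    rw [← two_mul_rootForm_root] at this
    linarith
  | insert i s _ ih =>
    obtain ⟨y, hy, hy'⟩ := ih
    by_cases hi : P.toLinearMap (P.root i) y = 0
    -- Scaling by `N` leaves room to add `α_i^∨` without changing the sign of any nonzero value,
    -- while the value on `α_i` becomes 2.
    · let N : ℤ := ∑ j, |P.pairing j i| + 1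
      have hN (j : ι) : |P.pairing j i| < N :=
        Int.lt_add_one_of_le
          (Finset.single_le_sum (f := fun j ↦ |P.pairing j i|) (fun _ _ ↦ abs_nonneg _)
            (Finset.mem_univ j))
      have hval (j : ι) : P.toLinearMap (P.root j) (N • y + P.coroot i) =
          N * P.toLinearMap (P.root j) y + P.pairing j i := by simp
      refine ⟨N • y + P.coroot i, fun j hj ↦ ?_, fun j hj ↦ ?_⟩
      · rw [hval]
        rcases Finset.mem_insert.mp hj with rfl | hj
        · simp [hi]
        · intro h0
          have h1 : |N * P.toLinearMap (P.root j) y| = |P.pairing j i| := by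
            rw [eq_neg_of_add_eq_zero_left h0, abs_neg]
          rw [abs_mul] at h1
          have h2 := Int.one_le_abs (hy j hj)
          have h3 := hN j
          have h4 := le_abs_self N
          have h5 := abs_nonneg (P.pairing j i)
          nlinarith
      · rw [hval]
        have h2 := hy' j hj
        have h3 := hN j
        have h4 := neg_abs_le (P.pairing j i)
        have h5 := abs_nonneg (P.pairing j i)
        nlinarith
    · exact ⟨y, by simpa [hi] using hy, hy'⟩

/-- Among nonnegative combinations of a linearly independent family, the members of the family span
extremal rays. -/
lemma mem_span_singleton_of_smul_eq_add {κ M : Type*} [AddCommGroup M] {v : κ → M} {s : Set κ}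
    (hs : s.Finite) (hv : LinearIndepOn ℤ v s) {i : κ} (hi : i ∈ s) {x y : M}
    (hx : x ∈ AddSubmonoid.closure (v '' s)) (hy : y ∈ AddSubmonoid.closure (v '' s))
    {a b c : ℤ} (hb : 0 < b) (hc : 0 < c) (h : a • v i = b • x + c • y) :
    ∃ n : ℕ, x = n • v i := by
  classical
  have := hs.fintype
  rw [← Submodule.span_nat_eq_addSubmonoidClosure, Submodule.mem_toAddSubmonoid,
    Fintype.mem_span_image_iff_exists_fun] at hx hy
  obtain ⟨f, rfl⟩ := hx
  obtain ⟨g, rfl⟩ := hy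
  have h1 : ∑ k : s, (if k = ⟨i, hi⟩ then a else 0) • v k =
      ∑ k : s, (b * f k + c * g k) • v k := by
    simp only [ite_smul, zero_smul, Finset.sum_ite_eq', Finset.mem_univ, if_true, h,
      Finset.smul_sum, ← Finset.sum_add_distrib, add_smul, mul_smul, natCast_zsmul]
  have h2 := Fintype.linearIndependent_iffₛ.mp hv _ _ h1
  refine ⟨f ⟨i, hi⟩, Fintype.sum_eq_single (⟨i, hi⟩ : s) fun k hk ↦ ?_⟩
  have h3 := h2 k
  rw [if_neg hk] at h3
  have h4 : (f k : ℤ) = 0 := by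
    by_contra h0
    have h5 : 0 < (f k : ℤ) := by omega
    have h6 : 0 ≤ c * (g k : ℤ) := by positivity
    have h7 : 0 < b * (f k : ℤ) := by positivity
    omega
  rw [Int.natCast_eq_zero.mp h4, zero_smul]

open IsAddIndecomposable

variable {P}

/-- This is the relation between the `α^∨ = 2α/(α,α)` with denominators cleared. The polarization
kills the difference of the two sides, and the form is definite on the root span. -/
lemma length_smul_root_of_coroot_eq_add {i j k : ι}
    (h : P.coroot i = P.coroot j + P.coroot k) :
    (P.RootForm (P.root j) (P.root j) * P.RootForm (P.root k) (P.root k)) • P.root i =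
      (P.RootForm (P.root i) (P.root i) * P.RootForm (P.root k) (P.root k)) • P.root j +
      (P.RootForm (P.root i) (P.root i) * P.RootForm (P.root j) (P.root j)) • P.root k := by
  have hi := P.rootForm_self_smul_coroot i
  have hj := P.rootForm_self_smul_coroot j
  have hk := P.rootForm_self_smul_coroot k
  generalize P.RootForm (P.root i) (P.root i) = a at *
  generalize P.RootForm (P.root j) (P.root j) = b at *
  generalize P.RootForm (P.root k) (P.root k) = c at *
  have := Module.IsReflexive.of_isPerfPair P.flip.toLinearMap
  rw [← sub_eq_zero]
  have hmem (l : ι) : P.root l ∈ P.rootSpan ℤ := Submodule.subset_span ⟨l, rfl⟩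
  refine P.eq_zero_of_mem_rootSpan_of_rootForm_self_eq_zero
    (sub_mem (Submodule.smul_mem _ _ (hmem i))
      (add_mem (Submodule.smul_mem _ _ (hmem j)) (Submodule.smul_mem _ _ (hmem k)))) ?_
  suffices P.Polarization ((b * c) • P.root i - ((a * c) • P.root j + (a * b) • P.root k)) = 0 by
    rw [← P.toLinearMap_apply_apply_Polarization, this, map_zero]
  suffices (2 : ℤ) • P.Polarization
      ((b * c) • P.root i - ((a * c) • P.root j + (a * b) • P.root k)) = 0 from
    (smul_eq_zero.mp this).resolve_left two_ne_zero
  have key : (2 : ℤ) • P.Polarization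
      ((b * c) • P.root i - ((a * c) • P.root j + (a * b) • P.root k)) =
      (b * c) • (2 • P.Polarization (P.root i)) - ((a * c) • (2 • P.Polarization (P.root j)) +
        (a * b) • (2 • P.Polarization (P.root k))) := by
    simp only [map_sub, map_add, map_smul]
    module
  rw [key, ← hi, ← hj, ← hk, h]
  module

variable [P.IsReduced]

/-- If a coroot `α_i^∨` with `α_i` simple were a sum of two positive coroots, clearing lengths would
write a multiple of `α_i` as a positive combination of two positive roots. By extremality and
reducedness the first of these is `±α_i`: the plus sign makes the other coroot zero, the minus sign
contradicts positivity. -/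
lemma baseOf_root_subset_baseOf_coroot (f : X →ₗ[ℤ] ℤ) (g : Y →ₗ[ℤ] ℤ)
    (hf : ∀ i, f (P.root i) ≠ 0) (hfg : ∀ i, 0 < f (P.root i) ↔ 0 < g (P.coroot i)) :
    baseOf P.root (f : X →+ ℤ) ⊆ baseOf P.coroot (g : Y →+ ℤ) := by
  have := Module.IsReflexive.of_isPerfPair P.toLinearMap
  intro i hi
  refine ⟨(hfg i).mp hi.1, fun j hj k hk h ↦ ?_⟩
  exfalso
  have hmem (l : ι) (hl : 0 < g (P.coroot l)) :
      P.root l ∈ AddSubmonoid.closure (P.root '' baseOf P.root (f : X →+ ℤ)) := by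
    rw [AddSubmonoid.closure_image_isAddIndecomposable_baseOf]
    exact AddSubmonoid.subset_closure ⟨l, (hfg l).mpr hl, rfl⟩
  obtain ⟨n, hn⟩ := mem_span_singleton_of_smul_eq_add (Set.toFinite _)
    (P.linearIndepOn_root_baseOf' f hf) hi (hmem j hj) (hmem k hk)
    (mul_pos (rootForm_root_self_pos P i) (rootForm_root_self_pos P k))
    (mul_pos (rootForm_root_self_pos P i) (rootForm_root_self_pos P j))
    (length_smul_root_of_coroot_eq_add h)
  have hij : ¬ LinearIndependent ℤ ![P.root i, P.root j] := by
    simp only [LinearIndependent.pair_iff, not_forall]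
    exact ⟨n, -1, by simp [hn], by simp⟩
  rcases RootPairing.IsReduced.eq_or_eq_neg i j hij with hij | hij
  · obtain rfl := P.root.injective hij
    exact P.ne_zero' k (by simpa using h)
  · have h1 : 0 < f (P.root i) := hi.1
    have h2 := (hfg j).mpr hj
    rw [hij, map_neg] at h1
    omega

/-- The base attached to a regular coweight. -/
lemma exists_base_of_regular (y : Y) (hy : ∀ j, P.toLinearMap (P.root j) y ≠ 0) :
    ∃ b : P.Base, ∀ i ∈ b.support, 0 < P.toLinearMap (P.root i) y := by
  have := Module.IsReflexive.of_isPerfPair P.toLinearMap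
  have := Module.IsReflexive.of_isPerfPair P.flip.toLinearMap
  let f : X →ₗ[ℤ] ℤ := P.toLinearMap.flip y
  -- On each coroot, `g` has the sign of `f` on the corresponding root, so both functionals select
  -- the same simple indices.
  let g : Y →ₗ[ℤ] ℤ := P.flip.RootForm y
  have hg (i : ι) : 2 * g (P.coroot i) =
      P.flip.RootForm (P.coroot i) (P.coroot i) * f (P.root i) :=
    two_mul_rootForm_root P.flip y i
  have hpos (i : ι) : 0 < P.flip.RootForm (P.coroot i) (P.coroot i) :=
    rootForm_root_self_pos P.flip i
  have hg0 (i : ι) : g (P.coroot i) ≠ 0 := fun h ↦ by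
    have := hg i
    rw [h, mul_zero, eq_comm, mul_eq_zero] at this
    exact this.elim (hpos i).ne' (hy i)
  have hfg (i : ι) : 0 < f (P.root i) ↔ 0 < g (P.coroot i) := by
    rw [← mul_pos_iff_of_pos_left (hpos i), ← hg, mul_pos_iff_of_pos_left two_pos]
  have hbase : baseOf P.root (f : X →+ ℤ) = baseOf P.coroot (g : Y →+ ℤ) :=
    (baseOf_root_subset_baseOf_coroot f g hy hfg).antisymm
      (baseOf_root_subset_baseOf_coroot (P := P.flip) g f hg0 fun i ↦ (hfg i).symm)
  let := P.indexNeg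
  refine ⟨{
    support := (Set.toFinite (baseOf P.root (f : X →+ ℤ))).toFinset
    linearIndepOn_root := by simpa using P.linearIndepOn_root_baseOf' f hy
    linearIndepOn_coroot := by
      rw [Set.Finite.coe_toFinset, hbase]
      exact P.flip.linearIndepOn_root_baseOf' g hg0
    root_mem_or_neg_mem := fun i ↦ by
      rw [Set.Finite.coe_toFinset]
      exact mem_or_neg_mem_closure_baseOf P.root (f : X →+ ℤ) i (hy i) (by simp)
    coroot_mem_or_neg_mem := fun i ↦ by
      rw [Set.Finite.coe_toFinset, hbase]
      exact mem_or_neg_mem_closure_baseOf P.coroot (g : Y →+ ℤ) i (hg0 i) (by simp) },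
    fun i hi ↦ ?_⟩
  rw [Set.Finite.mem_toFinset] at hi
  exact hi.1

/-- Every weight is dominant for some base. -/
lemma exists_base_dominant (P : RootDatum ι X Y) [P.IsReduced] (χ : X) :
    ∃ b : P.Base, ∀ i ∈ b.support, 0 ≤ P.toLinearMap χ (P.coroot i) := by
  obtain ⟨y, hy, hχ⟩ := exists_regular_coweight P χ
  obtain ⟨b, hb⟩ := exists_base_of_regular y hy
  refine ⟨b, fun i hi ↦ ?_⟩
  by_contra! h
  have h1 := hχ (P.reflectionPerm i i) (by simpa using h)
  have h2 := hb i hi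
  simp only [RootPairing.root_reflectionPerm, RootPairing.reflection_apply_self, map_neg,
    LinearMap.neg_apply] at h1
  omega

end Base

/-! ### A root with full support on the simple roots. -/

section FullSupport

variable [Fintype ι] {P : RootDatum ι X Y}

lemma pairing_eq_zero_of_rootForm_eq_zero {i j : ι}
    (h : P.RootForm (P.root i) (P.root j) = 0) : P.pairing i j = 0 := by
  have h1 := two_mul_rootForm_root P (P.root i) j
  rw [h, mul_zero, eq_comm, mul_eq_zero] at h1
  exact h1.resolve_left (rootForm_root_self_pos P j).ne'

lemma rootForm_eq_zero_of_pairing_eq_zero {i j : ι}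
    (h : P.pairing i j = 0) : P.RootForm (P.root i) (P.root j) = 0 := by
  have h1 := two_mul_rootForm_root P (P.root i) j
  rw [RootPairing.root_coroot_eq_pairing, h, mul_zero] at h1
  omega

variable [P.IsReduced]

/-- In an irreducible root datum, the simple roots do not split into two orthogonal parts. -/
lemma IsSimple.exists_pairing_ne_zero_of_base (hP : IsSimple P) (b : P.Base) {s : Set ι}
    (hne : s.Nonempty) (hne' : ((b.support : Set ι) \ s).Nonempty) :
    ∃ i ∈ s, ∃ j ∈ (b.support : Set ι) \ s, P.pairing i j ≠ 0 := by
  by_contra! h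
  have hform : ∀ x ∈ Submodule.span ℤ (P.root '' s),
      ∀ y ∈ Submodule.span ℤ (P.root '' ((b.support : Set ι) \ s)), P.RootForm x y = 0 := by
    intro x hx y hy
    induction hx using Submodule.span_induction with
    | mem x hx =>
      obtain ⟨i, hi, rfl⟩ := hx
      induction hy using Submodule.span_induction with
      | mem y hy =>
        obtain ⟨j, hj, rfl⟩ := hy
        exact rootForm_eq_zero_of_pairing_eq_zero (h i hi j hj)
      | zero => simp
      | add y z _ _ hy hz => simp [hy, hz]
      | smul a y _ hy => simp [hy]
    | zero => simp
    | add y z _ _ hy hz => simp [hy, hz]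
    | smul a y _ hy => simp [hy]
  -- Every root comes from simple roots by simple reflections, and these preserve each of the two
  -- orthogonal spans.
  have hsplit (i : ι) : P.root i ∈ Submodule.span ℤ (P.root '' s) ∨
      P.root i ∈ Submodule.span ℤ (P.root '' ((b.support : Set ι) \ s)) := by
    refine b.induction_reflect i (p := fun i ↦ P.root i ∈ Submodule.span ℤ (P.root '' s) ∨
      P.root i ∈ Submodule.span ℤ (P.root '' ((b.support : Set ι) \ s))) ?_ ?_ ?_
    · intro i hi
      simpa using hi
    · intro i hi
      by_cases his : i ∈ s
      · exact .inl (Submodule.subset_span ⟨i, his, rfl⟩)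
      · exact .inr (Submodule.subset_span ⟨i, ⟨hi, his⟩, rfl⟩)
    · intro i j hi hj
      rw [← P.reflectionPerm_root j i, RootPairing.root_coroot_eq_pairing]
      by_cases hjs : j ∈ s
      · have hj' : P.root j ∈ Submodule.span ℤ (P.root '' s) := Submodule.subset_span ⟨j, hjs, rfl⟩
        rcases hi with hi | hi
        · exact .inl (sub_mem hi (Submodule.smul_mem _ _ hj'))
        · right
          rw [P.pairing_eq_zero_iff'.mp (pairing_eq_zero_of_rootForm_eq_zero (hform _ hj' _ hi))]
          simpa using hi
      · have hj' : P.root j ∈ Submodule.span ℤ (P.root '' ((b.support : Set ι) \ s)) :=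
          Submodule.subset_span ⟨j, ⟨hj, hjs⟩, rfl⟩
        rcases hi with hi | hi
        · left
          rw [pairing_eq_zero_of_rootForm_eq_zero (hform _ hi _ hj')]
          simpa using hi
        · exact .inr (sub_mem hi (Submodule.smul_mem _ _ hj'))
  obtain ⟨i, hi⟩ := hne
  obtain ⟨j, hj⟩ := hne'
  have hi' : P.root i ∈ Submodule.span ℤ (P.root '' s) := Submodule.subset_span ⟨i, hi, rfl⟩
  have hj' : P.root j ∈ Submodule.span ℤ (P.root '' ((b.support : Set ι) \ s)) :=
    Submodule.subset_span ⟨j, hj, rfl⟩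
  obtain ⟨k, hk, l, hl, hkl⟩ := hP.2 {k | P.root k ∈ Submodule.span ℤ (P.root '' s)} ⟨i, hi'⟩
    ⟨j, fun hj'' ↦ (rootForm_root_self_pos P j).ne' (hform _ hj'' _ hj')⟩
  exact hkl (pairing_eq_zero_of_rootForm_eq_zero (hform _ hk _ ((hsplit l).resolve_left hl)))

/-- In an irreducible root datum, some root involves all simple roots with positive coefficients. -/
lemma IsSimple.exists_root_eq_sum_pos (hP : IsSimple P) (b : P.Base) :
    ∃ (i : ι) (c : ι → ℤ), (∀ j ∈ b.support, 0 < c j) ∧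
      P.root i = ∑ j ∈ b.support, c j • P.root j := by
  have := Module.IsReflexive.of_isPerfPair P.toLinearMap
  have := hP.1
  obtain ⟨i, hi⟩ := Finite.exists_max b.height
  obtain ⟨c, hc, hc', hsum⟩ := b.exists_root_eq_sum_int i
  obtain ⟨l, hl⟩ := b.support_nonempty
  have hpos : b.IsPos i := by
    rw [RootPairing.Base.isPos_iff]
    have := hi l
    rw [RootPairing.Base.height_one_of_mem_support hl] at this
    omega
  replace hc' : 0 < c := by
    refine hc'.resolve_right fun hneg ↦ ?_
    rw [RootPairing.Base.isPos_iff, RootPairing.Base.height_eq_sum hsum] at hpos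
    exact absurd hpos (not_lt.mpr (Finset.sum_nonpos fun j _ ↦ hneg.le j))
  have hdom : ∀ j ∈ b.support, 0 ≤ P.pairing i j := by
    intro j hj
    by_contra! hlt
    have hne : P.root i ≠ -P.root j := by
      intro h
      have h0 : P.root (P.reflectionPerm j j) = P.root i := by simp [h]
      have h1 := b.height_reflectionPerm_self j
      have h2 : b.height (P.reflectionPerm j j) = -b.height j := h1
      rw [P.root.injective h0, RootPairing.Base.height_one_of_mem_support hj] at h2
      rw [RootPairing.Base.isPos_iff] at hpos
      omega
    obtain ⟨k, hk⟩ := P.root_add_root_mem_of_pairingIn_neg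
      (by rwa [pairingIn_int_eq]) hne
    have h1 := b.height_add hk
    rw [RootPairing.Base.height_one_of_mem_support hj] at h1
    have := hi k
    omega
  refine ⟨i, c, fun j hj ↦ ?_, hsum⟩
  by_contra hj0
  replace hj0 : c j = 0 := le_antisymm (not_lt.mp hj0) (hc'.le j)
  have hne : (Function.support c).Nonempty := by
    rw [Function.support_nonempty_iff]
    exact hc'.ne'
  -- A simple root `l` outside the support but linked to it pairs negatively with root `i`, against
  -- dominance.
  obtain ⟨k, hk, l, hl, hkl⟩ := hP.exists_pairing_ne_zero_of_base b hne
    ⟨j, hj, by simpa using hj0⟩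
  have hle (m : ι) (hm : m ∈ b.support) : c m * P.pairing m l ≤ 0 := by
    by_cases hml : m = l
    · subst hml
      have : c m = 0 := by simpa using hl.2
      simp [this]
    · have := b.pairingIn_le_zero_of_ne hml hm hl.1
      rw [pairingIn_int_eq] at this
      exact mul_nonpos_of_nonneg_of_nonpos (hc'.le m) this
  have hlt : c k * P.pairing k l < 0 :=
    lt_of_le_of_ne (hle k (hc hk)) (mul_ne_zero hk hkl)
  have hil : P.pairing i l = ∑ m ∈ b.support, c m * P.pairing m l := by
    rw [← P.root_coroot_eq_pairing, hsum]
    simp [LinearMap.sum_apply]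
  have := Finset.sum_neg' hle ⟨k, hc hk, hlt⟩
  have := hdom l hl.1
  omega

end FullSupport

end RootDatum

namespace RootDatum

variable {ι X Y : Type*} [AddCommGroup X] [AddCommGroup Y]

/-! ### Divisibility of characters and rational pairings. -/

section Multiples

variable {P : RootDatum ι X Y}

lemma IsSimplyConnected.toLinearMap_ext (hP : IsSimplyConnected P) {χ ψ : X}
    (h : ∀ i, P.toLinearMap χ (P.coroot i) = P.toLinearMap ψ (P.coroot i)) : χ = ψ := by
  refine P.toPerfPair.injective (LinearMap.ext_on_range hP fun i ↦ ?_)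
  simpa using h i

/-- In the simply connected case, a character is divisible as soon as its values on coroots are. -/
lemma IsSimplyConnected.exists_eq_smul (hP : IsSimplyConnected P) {χ : X} {m : ℤ}
    (h : ∀ i, m ∣ P.toLinearMap χ (P.coroot i)) :
    ∃ ξ : X, χ = m • ξ ∧
      ∀ i, P.toLinearMap χ (P.coroot i) = m * P.toLinearMap ξ (P.coroot i) := by
  have hdvd (y : Y) : m ∣ P.toLinearMap χ y := by
    have hy : y ∈ Submodule.span ℤ (Set.range P.coroot) := by
      rw [show Submodule.span ℤ (Set.range P.coroot) = ⊤ from hP]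
      trivial
    induction hy using Submodule.span_induction with
    | mem y hy => obtain ⟨i, rfl⟩ := hy; exact h i
    | zero => simp
    | add y z _ _ hy hz => rw [map_add]; exact dvd_add hy hz
    | smul a y _ hy => rw [map_smul]; exact hy.mul_left a
  let φ : Y →ₗ[ℤ] ℤ := AddMonoidHom.toIntLinearMap
    { toFun := fun y ↦ P.toLinearMap χ y / m
      map_zero' := by simp
      map_add' := fun y z ↦ by rw [map_add, Int.add_ediv_of_dvd_left (hdvd y)] }
  have hφ (y : Y) : P.toLinearMap (P.toPerfPair.symm φ) y = P.toLinearMap χ y / m := by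
    change P.toPerfPair (P.toPerfPair.symm φ) y = _
    rw [LinearEquiv.apply_symm_apply]
    rfl
  have hval (i : ι) : P.toLinearMap χ (P.coroot i) =
      m * P.toLinearMap (P.toPerfPair.symm φ) (P.coroot i) := by
    rw [hφ, Int.mul_ediv_cancel' (hdvd _)]
  exact ⟨P.toPerfPair.symm φ, hP.toLinearMap_ext fun i ↦ by simpa using hval i, hval⟩

lemma ratPairing_tmul (P : RootDatum ι X Y) (i : ι) (q : ℚ) (χ : X) :
    P.ratPairing i (q ⊗ₜ[ℤ] χ) = q * P.toLinearMap χ (P.coroot i) := by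
  simp [ratPairing]

/-- The rational pairing with a fixed element is additive in the coroot. -/
lemma ratPairing_eq_sum {s : Finset ι} {c : ι → ℤ} {i : ι}
    (h : P.coroot i = ∑ j ∈ s, c j • P.coroot j) (ξ : ℚ ⊗[ℤ] X) :
    P.ratPairing i ξ = ∑ j ∈ s, c j * P.ratPairing j ξ := by
  induction ξ using TensorProduct.induction_on with
  | zero => simp
  | tmul q χ =>
    simp only [ratPairing_tmul, h, map_sum, map_smul, smul_eq_mul, Int.cast_sum, Int.cast_mul,
      Finset.mul_sum]
    exact Finset.sum_congr rfl fun j _ ↦ by ring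
  | add x y hx hy =>
    simp only [map_add, hx, hy, mul_add, Finset.sum_add_distrib]

end Multiples

/-! ### The characterization for irreducible root data. -/

section Main

lemma IsMinuscule.isQuasiConstant_smul {P : RootDatum ι X Y} {ξ : X} (h : IsMinuscule P ξ) (m : ℤ) :
    IsQuasiConstant P (m • ξ) := by
  rw [isQuasiConstant_iff]
  intro i w hi
  have h1 := h i
  have h2 := h (P.weylGroupToPerm w i)
  simp only [map_smul, LinearMap.smul_apply, smul_eq_mul, Set.mem_insert_iff,
    Set.mem_singleton_iff] at *
  generalize P.toLinearMap ξ (P.coroot (P.weylGroupToPerm w i)) = y at *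
  generalize P.toLinearMap ξ (P.coroot i) = x at *
  rcases h1 with rfl | rfl | rfl <;> rcases h2 with rfl | rfl | rfl <;> simp at *

variable [Fintype ι] {P : RootDatum ι X Y}

/-- `(α,α)⟨ξ,α^∨⟩` and `(α_i,α_i)⟨α,η⟩` are both linear in `α` and agree on simple roots, hence on
all roots. So the nonzero values of `ξ` depend, up to sign, only on the length of the root. -/
lemma IsCominuscule.isQuasiConstant_smul {ξ : X} (h : IsCominuscule P ξ) (m : ℤ) :
    IsQuasiConstant P (m • ξ) := by
  obtain ⟨b, i, hi, ⟨hξi, hξ⟩, η, ⟨hηi, hη⟩, hmin⟩ := h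
  simp only [ratPairing_tmul, one_mul] at hξi hξ
  let len (j : ι) : ℤ := P.RootForm (P.root j) (P.root j)
  have hval (j : ι) : (len j : ℚ) * P.toLinearMap ξ (P.coroot j) =
      len i * ratPairing P.flip j η := by
    obtain ⟨c, -, -, hc⟩ := b.exists_root_eq_sum_int j
    have h1 : (len j : ℚ) * P.toLinearMap ξ (P.coroot j) =
        ∑ k ∈ b.support, c k * ((len k : ℚ) * P.toLinearMap ξ (P.coroot k)) := by
      have h2 : len j * P.toLinearMap ξ (P.coroot j) =
          ∑ k ∈ b.support, c k * (len k * P.toLinearMap ξ (P.coroot k)) := by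
        simp only [len, ← two_mul_rootForm_root]
        rw [hc, map_sum, Finset.mul_sum]
        exact Finset.sum_congr rfl fun k _ ↦ by rw [map_smul, smul_eq_mul]; ring
      exact_mod_cast h2
    rw [h1, ratPairing_eq_sum (P := P.flip) hc, Finset.mul_sum]
    refine Finset.sum_congr rfl fun k hk ↦ ?_
    by_cases hki : k = i
    · subst hki
      rw [hξi, hηi]
      ring
    · rw [hξ k hk hki, hη k hk hki]
      ring
  have hlen (j : ι) : (len j : ℚ) ≠ 0 := by exact_mod_cast (rootForm_root_self_pos P j).ne'
  have habs (j : ι) : P.toLinearMap ξ (P.coroot j) = 0 ∨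
      len j * |P.toLinearMap ξ (P.coroot j)| = len i := by
    have hpos : 0 < len j := rootForm_root_self_pos P j
    have hpos' : 0 < len i := rootForm_root_self_pos P i
    have h1 := hval j
    rcases hmin j with h0 | h0 | h0
    · rw [h0, mul_zero, mul_eq_zero] at h1
      exact .inl (by exact_mod_cast h1.resolve_left (hlen j))
    · rw [h0, mul_one] at h1
      right
      rw [← abs_of_pos hpos, ← abs_mul, ← abs_of_pos hpos']
      exact congrArg _ (by exact_mod_cast h1)
    · rw [Set.mem_singleton_iff] at h0
      rw [h0, mul_neg, mul_one] at h1
      right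
      rw [← abs_of_pos hpos, ← abs_mul, ← abs_of_pos hpos', ← abs_neg (len i)]
      exact congrArg _ (by exact_mod_cast h1)
  rw [isQuasiConstant_iff]
  intro j w hj
  simp only [map_smul, LinearMap.smul_apply, smul_eq_mul, abs_mul, mul_eq_zero, ne_eq] at *
  rw [not_or] at hj
  have h1 := (habs j).resolve_left hj.2
  rcases habs (P.weylGroupToPerm w j) with h2 | h2
  · exact .inl (.inr h2)
  · right
    rw [show len (P.weylGroupToPerm w j) = len j from rootForm_root_weylGroup P w j, ← h1] at h2
    rw [mul_left_cancel₀ (rootForm_root_self_pos P j).ne' h2]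

variable [P.IsReduced]

/-- If the values of `χ` on coroots are inversely proportional to the lengths of the roots, then
`χ` is a multiple of a cominuscule character. -/
lemma IsSimplyConnected.exists_isCominuscule (hP : IsSimple P) (hsc : IsSimplyConnected P) {χ : X}
    (hχ : χ ≠ 0) {c : ℤ} (h : ∀ j, P.toLinearMap χ (P.coroot j) ≠ 0 →
      P.RootForm (P.root j) (P.root j) * |P.toLinearMap χ (P.coroot j)| = c) :
    ∃ (m : ℤ) (ξ : X), IsCominuscule P ξ ∧ χ = m • ξ := by
  have := Module.IsReflexive.of_isPerfPair P.toLinearMap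
  obtain ⟨b, hb⟩ := exists_base_dominant P χ
  have hlen (j : ι) := rootForm_root_self_pos P j
  have hcoroot (j : ι) : ∃ a : ι → ℤ, P.coroot j = ∑ k ∈ b.support, a k • P.coroot k := by
    obtain ⟨a, -, -, ha⟩ := b.flip.exists_root_eq_sum_int j
    exact ⟨a, ha⟩
  obtain ⟨i, hi, hi0⟩ : ∃ i ∈ b.support, P.toLinearMap χ (P.coroot i) ≠ 0 := by
    by_contra! h0
    refine hχ (hsc.toLinearMap_ext fun j ↦ ?_)
    obtain ⟨a, ha⟩ := hcoroot j
    rw [ha, map_sum, map_zero, LinearMap.zero_apply]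
    exact Finset.sum_eq_zero fun k hk ↦ by rw [map_smul, h0 k hk, smul_zero]
  have hipos : 0 < P.toLinearMap χ (P.coroot i) := lt_of_le_of_ne (hb i hi) hi0.symm
  have hci : P.RootForm (P.root i) (P.root i) * P.toLinearMap χ (P.coroot i) = c := by
    rw [← h i hi0, abs_of_pos hipos]
  have hcpos : 0 < c := hci ▸ mul_pos (hlen i) hipos
  have huniq : ∀ j ∈ b.support, j ≠ i → P.toLinearMap χ (P.coroot j) = 0 := by
    classical
    intro j hj hji
    by_contra hj0
    have hjpos : 0 < P.toLinearMap χ (P.coroot j) := lt_of_le_of_ne (hb j hj) (Ne.symm hj0)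
    have hcj : P.RootForm (P.root j) (P.root j) * P.toLinearMap χ (P.coroot j) = c := by
      rw [← h j hj0, abs_of_pos hjpos]
    -- Here `2(χ, α_t)` is at least `(a i + a j) * c ≥ 2 * c`, whereas its size can only be `0` or
    -- `c`.
    obtain ⟨t, a, ha, hsum⟩ := hP.exists_root_eq_sum_pos b
    have ht : P.RootForm (P.root t) (P.root t) * P.toLinearMap χ (P.coroot t) =
        ∑ k ∈ b.support, a k *
          (P.RootForm (P.root k) (P.root k) * P.toLinearMap χ (P.coroot k)) := by
      simp only [← two_mul_rootForm_root]
      rw [hsum, map_sum, Finset.mul_sum]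
      exact Finset.sum_congr rfl fun k _ ↦ by rw [map_smul, smul_eq_mul]; ring
    have hle : ∑ k ∈ {i, j}, a k *
        (P.RootForm (P.root k) (P.root k) * P.toLinearMap χ (P.coroot k)) ≤
        P.RootForm (P.root t) (P.root t) * P.toLinearMap χ (P.coroot t) := by
      rw [ht]
      refine Finset.sum_le_sum_of_subset_of_nonneg (by simp [Finset.insert_subset_iff, hi, hj])
        fun k hk _ ↦ mul_nonneg (ha k hk).le (mul_nonneg (hlen k).le (hb k hk))
    rw [Finset.sum_pair hji.symm, hci, hcj] at hle
    have h1 : P.RootForm (P.root t) (P.root t) * P.toLinearMap χ (P.coroot t) ≤ c := by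
      by_cases h0 : P.toLinearMap χ (P.coroot t) = 0
      · simpa [h0] using hcpos.le
      · rw [← h t h0]
        exact mul_le_mul_of_nonneg_left (le_abs_self _) (hlen t).le
    have := ha i hi
    have := ha j hj
    nlinarith
  obtain ⟨ξ, hξ, hval⟩ := hsc.exists_eq_smul (χ := χ) (m := P.toLinearMap χ (P.coroot i)) fun j ↦ by
    obtain ⟨a, ha⟩ := hcoroot j
    rw [ha, map_sum]
    refine Finset.dvd_sum fun k hk ↦ ?_
    rw [map_smul]
    by_cases hki : k = i
    · subst hki; exact Dvd.intro_left _ rfl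
    · simp [huniq k hk hki]
  -- The factor `2 / c` makes the coweight take the value `(α,α)⟨χ,α^∨⟩ / c`, which is `0` or `±1`,
  -- on each root `α`.
  refine ⟨_, ξ, ⟨b, i, hi, ⟨?_, ?_⟩, ((2 / c : ℚ) ⊗ₜ P.Polarization χ), ⟨?_, ?_⟩, ?_⟩, hξ⟩
  · have h1 := hval i
    rw [ratPairing_tmul, one_mul]
    have : P.toLinearMap ξ (P.coroot i) = 1 := mul_left_cancel₀ hi0 (by rw [← h1, mul_one])
    exact_mod_cast this
  · intro j hj hji
    have h1 := hval j
    rw [huniq j hj hji, eq_comm, mul_eq_zero] at h1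
    rw [ratPairing_tmul, h1.resolve_left hi0]
    simp
  all_goals
    have hc0 : (c : ℚ) ≠ 0 := by exact_mod_cast hcpos.ne'
    have hη (j : ι) : ratPairing P.flip j ((2 / c : ℚ) ⊗ₜ P.Polarization χ) =
        ((P.RootForm (P.root j) (P.root j) * P.toLinearMap χ (P.coroot j) : ℤ) : ℚ) / c := by
      rw [ratPairing_tmul, ← two_mul_rootForm_root, ← P.toLinearMap_apply_apply_Polarization]
      simp only [RootPairing.flip_toLinearMap, LinearMap.flip_apply, RootPairing.flip_coroot]
      push_cast
      ring
  · rw [hη, hci, div_self hc0]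
  · intro j hj hji
    rw [hη, huniq j hj hji]
    simp
  · intro j
    rw [hη]
    by_cases h0 : P.toLinearMap χ (P.coroot j) = 0
    · simp [h0]
    · have h1 := h j h0
      rcases abs_choice (P.toLinearMap χ (P.coroot j)) with h2 | h2
      · rw [h2] at h1
        simp [h1, hc0]
      · rw [h2, mul_neg, neg_eq_iff_eq_neg] at h1
        rw [h1]
        simp [hc0]

/-- For an irreducible simply connected root datum, the quasi-constant characters are the multiples
of the minuscule and the cominuscule ones. -/
theorem IsSimplyConnected.isQuasiConstant_iff (hP : IsSimple P) (hsc : IsSimplyConnected P)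
    (χ : X) :
    IsQuasiConstant P χ ↔
      ∃ (m : ℤ) (ξ : X), (IsMinuscule P ξ ∨ IsCominuscule P ξ) ∧ χ = m • ξ := by
  constructor
  · intro hχ
    by_cases h0 : χ = 0
    · exact ⟨0, 0, .inl fun i ↦ by simp, by simp [h0]⟩
    obtain ⟨i, hi⟩ : ∃ i, P.toLinearMap χ (P.coroot i) ≠ 0 := by
      by_contra! h
      exact h0 (hsc.toLinearMap_ext fun j ↦ by simp [h])
    by_cases hall : ∀ j, P.toLinearMap χ (P.coroot j) ≠ 0 →
        |P.toLinearMap χ (P.coroot j)| = |P.toLinearMap χ (P.coroot i)|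
    · obtain ⟨ξ, hξ, hval⟩ := hsc.exists_eq_smul (χ := χ) (m := P.toLinearMap χ (P.coroot i)) fun j ↦ by
        by_cases hj : P.toLinearMap χ (P.coroot j) = 0
        · simp [hj]
        · rw [← abs_dvd_abs, hall j hj]
      refine ⟨_, ξ, .inl fun j ↦ ?_, hξ⟩
      by_cases hj : P.toLinearMap χ (P.coroot j) = 0
      · rw [hval j, mul_eq_zero] at hj
        exact .inl (hj.resolve_left hi)
      · have h1 := hall j hj
        rw [hval j, abs_mul] at h1
        have h2 : |P.toLinearMap ξ (P.coroot j)| = 1 :=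
          mul_left_cancel₀ (abs_ne_zero.mpr hi) (by rw [h1, mul_one])
        exact .inr (by simpa [abs_eq] using h2)
    · push Not at hall
      obtain ⟨j, hj, hij⟩ := hall
      have hji := (hχ.abs_eq_or_length_mul_abs_eq hP hj hi).resolve_left hij
      -- The values at `i` and `j` differ in size, so the value at any `l` differs in size from one
      -- of them; the length relation with that one transfers to `i`.
      obtain ⟨m, ξ, hξ, hm⟩ := hsc.exists_isCominuscule hP h0
        (c := P.RootForm (P.root i) (P.root i) * |P.toLinearMap χ (P.coroot i)|) fun l hl ↦ by
          rcases hχ.abs_eq_or_length_mul_abs_eq hP hl hi with h1 | h1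
          · rcases hχ.abs_eq_or_length_mul_abs_eq hP hl hj with h2 | h2
            · exact absurd (h2.symm.trans h1) hij
            · exact h2.trans hji
          · exact h1
      exact ⟨m, ξ, .inr hξ, hm⟩
  · rintro ⟨m, ξ, h | h, rfl⟩
    · exact h.isQuasiConstant_smul m
    · exact h.isQuasiConstant_smul m

end Main

lemma IsSimple.flip {P : RootDatum ι X Y} (hP : IsSimple P) : IsSimple P.flip := by
  refine ⟨hP.1, fun s hs hs' ↦ ?_⟩
  obtain ⟨i, hi, j, hj, h⟩ := hP.2 s hs hs'
  exact ⟨i, hi, j, hj, fun h0 ↦ h (P.pairing_eq_zero_iff'.mp h0)⟩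

end RootDatum

/-! ### Finiteness of the root set, and the theorem for groups. -/

namespace LinAlgGroup

variable {k : Type*} [Field k] {n : ℕ} {G : Subgroup (GL (Fin n) k)}

/-- The adjoint action of an element of a maximal torus on the space of matrices. -/
def conjEnd (T : MaximalTorus G) (t : T.toSubgroup) :
    Module.End k (Matrix (Fin n) (Fin n) k) :=
  LinearMap.mulLeft k ((t : GL (Fin n) k) : Matrix (Fin n) (Fin n) k) *
    LinearMap.mulRight k ((t⁻¹ : T.toSubgroup) : GL (Fin n) k).1

lemma conjEnd_apply (T : MaximalTorus G) (t : T.toSubgroup) (A : Matrix (Fin n) (Fin n) k) :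
    conjEnd T t A = ((t : GL (Fin n) k) : Matrix (Fin n) (Fin n) k) * A
      * ((t⁻¹ : T.toSubgroup) : GL (Fin n) k).1 := by
  simp [conjEnd, mul_assoc]

lemma conjEnd_mul (T : MaximalTorus G) (s t : T.toSubgroup) :
    conjEnd T (s * t) = conjEnd T s * conjEnd T t := by
  ext1 A
  rw [Module.End.mul_apply, conjEnd_apply, conjEnd_apply, conjEnd_apply]
  simp only [Subgroup.coe_mul, mul_inv_rev, Units.val_mul, mul_assoc]

/-- Roots are weights of a commuting family of endomorphisms of a finite-dimensional space. Its
simultaneous generalized eigenspaces are independent, so only finitely many are nonzero. -/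
instance finite_roots (T : MaximalTorus G) : Finite (roots T) := by
  have hcomm (s t : T.toSubgroup) : Commute (conjEnd T s) (conjEnd T t) := by
    rw [Commute, SemiconjBy, ← conjEnd_mul, ← conjEnd_mul, T.isTorus.mul_comm]
  have hfin := WellFoundedGT.finite_ne_bot_of_iSupIndep
    (Module.End.independent_iInf_maxGenEigenspace_of_forall_mapsTo (conjEnd T)
      fun s t φ ↦ Module.End.mapsTo_maxGenEigenspace_of_comm (hcomm t s) φ)
  refine Set.Finite.of_finite_image (f := fun (α : CharGroup T) t ↦ (α.hom t : k))
    (hfin.subset ?_) ?_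
  · rintro - ⟨α, ⟨-, A, hA, -, hα⟩, rfl⟩
    rw [Set.mem_ofPred_eq, Submodule.ne_bot_iff]
    refine ⟨A, (Submodule.mem_iInf _).mpr fun t ↦ ?_, hA⟩
    refine Module.End.genEigenspace_le_maximal _ _ 1 ?_
    rw [Nat.cast_one, Module.End.genEigenspace_one, LinearMap.mem_ker, LinearMap.sub_apply,
      conjEnd_apply, hα t]
    simp
  · intro α _ β _ h
    refine Additive.toMul.injective (Subtype.ext (MonoidHom.ext fun t ↦ Units.ext ?_))
    exact congrFun h t

end LinAlgGroup

theorem theorem1p2p1 {k : Type*} [Field k] [IsAlgClosed k] {n : ℕ}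
    (G : Subgroup (GL (Fin n) k)) (hG : LinAlgGroup.IsConnectedReductive G)
    (T : LinAlgGroup.MaximalTorus G)
    (P : RootDatum (LinAlgGroup.roots T) (LinAlgGroup.CharGroup T) (LinAlgGroup.CocharGroup T))
    (hP : LinAlgGroup.IsRootDatum T P) (hsimple : RootDatum.IsSimple P) :
    (RootDatum.IsSimplyConnected P → ∀ χ : LinAlgGroup.CharGroup T,
      RootDatum.IsQuasiConstant P χ ↔
        ∃ (m : ℤ) (ξ : LinAlgGroup.CharGroup T),
          (RootDatum.IsMinuscule P ξ ∨ RootDatum.IsCominuscule P ξ) ∧ χ = m • ξ) ∧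
    (RootDatum.IsAdjoint P → ∀ μ : LinAlgGroup.CocharGroup T,
      RootDatum.IsQuasiConstant P.flip μ ↔
        ∃ (m : ℤ) (ν : LinAlgGroup.CocharGroup T),
          (RootDatum.IsMinuscule P.flip ν ∨ RootDatum.IsCominuscule P.flip ν) ∧ μ = m • ν) := by
  have := Fintype.ofFinite (LinAlgGroup.roots T)
  have := hP.isReduced
  have := Module.IsReflexive.of_isPerfPair P.toLinearMap
  have := Module.IsReflexive.of_isPerfPair P.flip.toLinearMap
  -- Adjointness of `P` is by definition simple connectedness of `P.flip`.
  exact ⟨fun hsc ↦ hsc.isQuasiConstant_iff hsimple, fun had ↦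
    RootDatum.IsSimplyConnected.isQuasiConstant_iff (P := P.flip) hsimple.flip had⟩
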